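/- Let $(W,S)$ be a finite Coxeter system of rank $m=|S|$, that is, $W$ is a finite group with a presentation $W=\langle S\mid (st)^{M(s,t)}=1\rangle$, where $M(s,s)=1$ and $M(s,t)=M(t,s)\ge 2$ for $s\neq t$. For $J\subseteq S$ let $\langle J\rangle\le W$ be the (standard) subgroup generated by $J$. For an integer $r\in\{-1,0,\dots,m\}$ let the order-$r$ Coxeter code $C_W(r)$ be the $\mathbb F_2$-linear span, in the space of functions $W\to\mathbb F_2$, of the indicator functions of the left cosets $\sigma\langle J\rangle$ with $\sigma\in W$, $J\subseteq S$ and $|J|=m-r$. If $\lfloor m/2\rfloor\le r\le m$, then the minimum Hamming distance of $C_W(r)$ is exactly $2^{m-r}$. Moreover, it is attained by the indicator function of a standard subgroup generated by commuting generators: there is a set $J\subseteq S$ of $m-r$ pairwise commuting generators such that the indicator function of $\langle J\rangle$ belongs to $C_W(r)$ and has Hamming weight $2^{m-r}$. -/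

import Mathlib

open scoped Pointwise

namespace CoxeterCode

/-- The indicator function of a subset of `W`, as a binary vector with coordinates in `W`. -/
noncomputable def indicator {W : Type*} (U : Set W) : W → ZMod 2 :=
  U.indicator 1

/-- The minimum Hamming distance between distinct codewords of a binary linear code
(`0` if there are no two distinct codewords). -/
noncomputable def minDist {W : Type*} [Fintype W] (C : Submodule (ZMod 2) (W → ZMod 2)) : ℕ :=
  sInf {d : ℕ | ∃ x ∈ C, ∃ y ∈ C, x ≠ y ∧ hammingDist x y = d}

variable {B W : Type*} [Group W] {M : CoxeterMatrix B}

/-- The standard subgroup generated by the simple generators indexed by `J`. -/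
def standardSubgroup (cs : CoxeterSystem M W) (J : Finset B) : Subgroup W :=
  Subgroup.closure (cs.simple '' (J : Set B))

/-- The order-`r` Coxeter code of a Coxeter system of rank `m`: the binary span of the indicator
functions of the standard left cosets `σ⟨J⟩` of rank `|J| = m - r`. -/
noncomputable def code [Fintype B] (cs : CoxeterSystem M W) (r : ℤ) :
    Submodule (ZMod 2) (W → ZMod 2) :=
  Submodule.span (ZMod 2)
    {f | ∃ (σ : W) (J : Finset B), (J.card : ℤ) = (Fintype.card B : ℤ) - r ∧
      f = indicator (σ • (standardSubgroup cs J : Set W))}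

end CoxeterCode

/-!
A codeword of order `r` sums to zero over every left coset of `⟨K⟩` when `|K| = r + 1`: two index
sets of sizes `m - r` and `r + 1` share a generator `s`, and `x ↦ x s` pairs off the points common
to the cosets `σ⟨J⟩` and `w⟨K⟩`. By the exchange condition `⟨J⟩ ∩ ⟨K⟩ = ⟨J ∩ K⟩`, and this alone
forces a nonzero function with these vanishing sums to have at least `2 ^ (m - r)` points in its
support, by induction on the number of generators.

Since `W` is finite, its geometric representation carries an invariant positive definite form. This
rules out cycles in the Coxeter graph, which is therefore bipartite, so at least half of the
generators commute pairwise; any `m - r` of them generate a subgroup of order `2 ^ (m - r)`.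
-/

namespace CoxeterCode

section Reflection

open Module Polynomial.Chebyshev Real

variable {V : Type*} [AddCommGroup V]

theorem commute_reflection {R : Type*} [CommRing R] [Module R V] {x y : V} {f g : Dual R V}
    (hf : f x = 2) (hg : g y = 2) (hfy : f y = 0) (hgx : g x = 0) :
    Commute (reflection hf) (reflection hg) := by
  ext v
  simp only [LinearEquiv.mul_apply, reflection_apply, map_sub, map_smul, hfy, hgx]
  module

theorem eval_S_sub_one_two_mul_cos_eq_zero {θ : ℝ} (hsin : sin θ ≠ 0) {k : ℤ}
    (hk : k * θ = π) : (S ℝ (k - 1)).eval (2 * cos θ) = 0 := by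
  refine eq_zero_of_ne_zero_of_mul_right_eq_zero hsin ?_
  rw [S_two_mul_real_cos, Int.cast_sub, Int.cast_one, sub_add_cancel, hk, sin_pi]

theorem eval_S_add_eval_S_sub_one_two_mul_cos_eq_zero {θ : ℝ} (hsin : sin θ ≠ 0) {k : ℤ}
    (hk : (2 * k + 1) * θ = 2 * π) :
    (S ℝ k).eval (2 * cos θ) + (S ℝ (k - 1)).eval (2 * cos θ) = 0 := by
  refine eq_zero_of_ne_zero_of_mul_right_eq_zero hsin ?_
  rw [add_mul, S_two_mul_real_cos, S_two_mul_real_cos, Int.cast_sub, Int.cast_one, sub_add_cancel,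
    show (k + 1) * θ = 2 * π - k * θ by linarith, sin_two_pi_sub, neg_add_cancel]

theorem reflection_mul_reflection_pow_eq_one [Module ℝ V] {x y : V} {f g : Dual ℝ V}
    (hf : f x = 2) (hg : g y = 2) {θ : ℝ} (hsin : sin θ ≠ 0) {n : ℕ} (hn : n * θ = 2 * π)
    (hfg : f y * g x = 2 + 2 * cos θ) : (reflection hf * reflection hg) ^ n = 1 := by
  ext v
  rw [reflection_mul_reflection_pow_apply hf hg n v (2 * cos θ) (by rw [hfg]; ring)]
  obtain ⟨k, rfl | rfl⟩ := n.even_or_odd'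
  · have hzero := eval_S_sub_one_two_mul_cos_eq_zero hsin (k := k) (by push_cast at hn ⊢; linarith)
    rw [show (((2 * k : ℕ) : ℤ) - 2) / 2 = k - 1 by omega,
      show (((2 * k : ℕ) : ℤ) - 1) / 2 = k - 1 by omega, hzero]
    simp
  · have hzero := eval_S_add_eval_S_sub_one_two_mul_cos_eq_zero hsin (k := k)
      (by push_cast at hn ⊢; linarith)
    rw [show (((2 * k + 1 : ℕ) : ℤ) - 2) / 2 = k - 1 by omega,
      show (((2 * k + 1 : ℕ) : ℤ) - 1) / 2 = k by omega,
      show (((2 * k + 1 : ℕ) : ℤ) - 3) / 2 = k - 1 by omega,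
      show ((2 * k + 1 : ℕ) : ℤ) / 2 = k by omega, hzero]
    simp

theorem two_mul_apply_of_reflection_invariant {R : Type*} [CommRing R] [Module R V]
    (Q : LinearMap.BilinForm R V) {x : V} {f : Dual R V} (hf : f x = 2)
    (hQ : ∀ u v, Q (reflection hf u) (reflection hf v) = Q u v) (v : V) :
    2 * Q x v = f v * Q x x := by
  have h := hQ x v
  rw [reflection_apply_self, reflection_apply] at h
  simp only [map_neg, map_sub, map_smul, LinearMap.neg_apply, smul_eq_mul] at h
  linear_combination -h

end Reflection

section PosDef

variable {K V : Type*} [Field K] [LinearOrder K] [IsStrictOrderedRing K] [AddCommGroup V]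
  [Module K V]

variable (K V) in
theorem exists_bilinForm_posDef : ∃ Q : LinearMap.BilinForm K V, ∀ v ≠ 0, 0 < Q v v := by
  let b := Module.Basis.ofVectorSpace K V
  refine ⟨(Finsupp.bilinearCombination K K ∘ₗ Finsupp.lcoeFun).compl₁₂ b.repr.toLinearMap
    b.repr.toLinearMap, fun v hv => ?_⟩
  have hsupp : (b.repr v).support.Nonempty := by simpa using hv
  simpa [Finsupp.bilinearCombination_apply, Finsupp.linearCombination_apply, Finsupp.sum] using
    Finset.sum_pos (fun i hi => mul_self_pos.2 (Finsupp.mem_support_iff.1 hi)) hsupp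

theorem exists_invariant_bilinForm_posDef {G : Type*} [Group G] [Finite G]
    (ρ : G →* V ≃ₗ[K] V) :
    ∃ Q : LinearMap.BilinForm K V,
      (∀ v ≠ 0, 0 < Q v v) ∧ ∀ g u v, Q (ρ g u) (ρ g v) = Q u v := by
  have := Fintype.ofFinite G
  obtain ⟨Q₀, hQ₀⟩ := exists_bilinForm_posDef K V
  let Q : LinearMap.BilinForm K V := ∑ g, Q₀.compl₁₂ (ρ g).toLinearMap (ρ g).toLinearMap
  have hQ (u v : V) : Q u v = ∑ g, Q₀ (ρ g u) (ρ g v) := by simp [Q, LinearMap.sum_apply]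
  refine ⟨Q, fun v hv => ?_, fun g u v => ?_⟩
  · rw [hQ]
    exact Finset.sum_pos (fun g _ => hQ₀ _ ((ρ g).map_ne_zero_iff.2 hv)) Finset.univ_nonempty
  · simp only [hQ, ← LinearEquiv.mul_apply, ← map_mul]
    exact Fintype.sum_equiv (Equiv.mulRight g) _ _ fun _ => rfl

/- If each vertex of `T` has two neighbours in `T`, each row of the Gram matrix on `T` has
nonpositive sum, so `∑ i ∈ T, v i` is isotropic or worse. -/
theorem isAcyclic_of_posDef {ι : Type*} {G : SimpleGraph ι} {Q : LinearMap.BilinForm K V}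
    (hQ : ∀ v ≠ 0, 0 < Q v v) {v : ι → V} (hv : LinearIndependent K v)
    (hnonpos : ∀ i j, i ≠ j → Q (v i) (v j) ≤ 0)
    (hadj : ∀ i j, G.Adj i j → 2 * Q (v i) (v j) ≤ -Q (v i) (v i)) : G.IsAcyclic := by
  classical
  intro a p hp
  let T := p.support.toFinset
  have hsum : ∑ i ∈ T, v i ≠ 0 := by
    intro h
    refine one_ne_zero (linearIndependent_iff'.1 hv T (fun _ => 1) (by simpa using h) a ?_)
    simp [T]
  have hrow {i : ι} (hi : i ∈ T) : ∑ j ∈ T, Q (v i) (v j) ≤ 0 := by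
    obtain ⟨j, k, hjk, hN⟩ := Set.ncard_eq_two.1
      (hp.ncard_neighborSet_toSubgraph_eq_two (List.mem_toFinset.1 hi))
    have hmem {l : ι} (hl : l ∈ p.toSubgraph.neighborSet i) : l ∈ T ∧ G.Adj i l :=
      ⟨List.mem_toFinset.2 (p.mem_verts_toSubgraph.1 (p.toSubgraph.edge_vert hl.symm)),
        hl.adj_sub⟩
    obtain ⟨hjT, hij⟩ := hmem (l := j) (by simp [hN])
    obtain ⟨hkT, hik⟩ := hmem (l := k) (by simp [hN])
    have hsub : {i, j, k} ⊆ T := by simp [Finset.insert_subset_iff, hi, hjT, hkT]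
    calc ∑ l ∈ T, Q (v i) (v l) ≤ ∑ l ∈ {i, j, k}, Q (v i) (v l) := by
          rw [← Finset.sum_sdiff hsub]
          refine add_le_of_nonpos_left (Finset.sum_nonpos fun l hl => hnonpos i l ?_)
          rintro rfl
          simp at hl
      _ = Q (v i) (v i) + (Q (v i) (v j) + Q (v i) (v k)) := by
          rw [Finset.sum_insert (by simp [hij.ne, hik.ne]), Finset.sum_pair hjk]
      _ ≤ 0 := by linarith [hadj i j hij, hadj i k hik]
  refine (hQ _ hsum).not_ge ?_
  simp only [map_sum, LinearMap.sum_apply]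
  rw [Finset.sum_comm]
  exact Finset.sum_nonpos fun i hi => hrow hi

end PosDef

theorem exists_isIndepSet_card_le_mul {V : Type*} [Fintype V] {G : SimpleGraph V} {n : ℕ}
    (hG : G.Colorable n) :
    ∃ I : Finset V, G.IsIndepSet I ∧ Fintype.card V ≤ n * I.card := by
  classical
  obtain ⟨c⟩ := hG
  obtain _ | ⟨⟨v⟩⟩ := isEmpty_or_nonempty V
  · exact ⟨∅, by simp⟩
  have : Nonempty (Fin n) := ⟨c v⟩
  obtain ⟨a, ha⟩ : ∃ a, Fintype.card V ≤ n * (Finset.univ.filter fun v => c v = a).card := by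
    have hsum : ∑ _a : Fin n, Fintype.card V ≤
        ∑ a, n * (Finset.univ.filter fun v => c v = a).card := by
      rw [← Finset.mul_sum, ← Finset.card_eq_sum_card_fiberwise fun v _ => Finset.mem_univ (c v)]
      simp
    simpa using Finset.exists_le_of_sum_le Finset.univ_nonempty hsum
  exact ⟨_, fun v hv w hw _ hvw => c.valid hvw (by simp_all), ha⟩

section Geometric

open Real

variable {B W : Type*} [Group W] {M : CoxeterMatrix B}

/-- The linear form `v ↦ 2⟨αᵢ, v⟩` on the geometric representation of a Coxeter matrix, whose
standard basis vectors are the simple roots `αᵢ`, with `⟨αᵢ, αⱼ⟩ = -cos (π / M i j)`. A bond of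
infinite order is encoded by `M i j = 0`, and then `π / 0 = 0` gives the usual value `-1`. -/
noncomputable def corootForm (M : CoxeterMatrix B) (i : B) : Module.Dual ℝ (B →₀ ℝ) :=
  Finsupp.linearCombination ℝ fun j => -2 * cos (π / M i j)

theorem corootForm_single (i j : B) :
    corootForm M i (Finsupp.single j 1) = -2 * cos (π / M i j) := by
  simp [corootForm]

theorem corootForm_single_self (i : B) : corootForm M i (Finsupp.single i 1) = 2 := by
  simp [corootForm_single]

/-- The reflection by which the `i`-th simple generator acts on the geometric representation. -/
noncomputable def simpleReflection (M : CoxeterMatrix B) (i : B) : (B →₀ ℝ) ≃ₗ[ℝ] (B →₀ ℝ) :=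
  Module.reflection (corootForm_single_self (M := M) i)

theorem simpleReflection_apply (i : B) (v : B →₀ ℝ) :
    simpleReflection M i v = v - corootForm M i v • Finsupp.single i 1 :=
  Module.reflection_apply _ _

theorem isLiftable_simpleReflection : M.IsLiftable (simpleReflection M) := by
  intro i j
  have hsq (i : B) : simpleReflection M i * simpleReflection M i = 1 :=
    mul_eq_one_iff_eq_inv.2 (Module.reflection_inv (corootForm_single_self i)).symm
  obtain rfl | hij := eq_or_ne i j
  · rw [hsq, one_pow]
  obtain h0 | h2 | h3 : M i j = 0 ∨ M i j = 2 ∨ 3 ≤ M i j := by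
    have := M.off_diagonal i j hij
    lia
  · rw [h0, pow_zero]
  · have hcomm : Commute (simpleReflection M i) (simpleReflection M j) :=
      commute_reflection _ _ (by simp [corootForm_single, h2])
        (by simp [corootForm_single, M.symmetric j i, h2])
    rw [h2, hcomm.mul_pow, pow_two, pow_two, hsq, hsq, one_mul]
  · have hM : (3 : ℝ) ≤ M i j := mod_cast h3
    have hsin : 0 < sin (2 * π / M i j) :=
      sin_pos_of_pos_of_lt_pi (by positivity)
        ((div_lt_iff₀ (by positivity)).2 (by nlinarith [pi_pos]))
    refine reflection_mul_reflection_pow_eq_one _ _ hsin.ne' (by field_simp) ?_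
    rw [corootForm_single, corootForm_single, M.symmetric j i, mul_div_assoc, cos_two_mul]
    ring

/-- The geometric representation of a Coxeter group. -/
noncomputable def geometricRep (cs : CoxeterSystem M W) : W →* ((B →₀ ℝ) ≃ₗ[ℝ] (B →₀ ℝ)) :=
  cs.lift ⟨simpleReflection M, isLiftable_simpleReflection⟩

theorem geometricRep_simple (cs : CoxeterSystem M W) (i : B) :
    geometricRep cs (cs.simple i) = simpleReflection M i :=
  cs.lift_apply_simple _ i

theorem geometricRep_apply_of_notMem (cs : CoxeterSystem M W) {J : Finset B} {w : W}
    (hw : w ∈ standardSubgroup cs J) {i : B} (hi : i ∉ J) (v : B →₀ ℝ) :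
    geometricRep cs w v i = v i := by
  induction hw using Subgroup.closure_induction generalizing v with
  | mem x hx =>
    obtain ⟨j, hj, rfl⟩ := hx
    have hij : i ≠ j := fun h => hi (h ▸ hj)
    simp [geometricRep_simple, simpleReflection_apply, hij]
  | one => simp
  | mul x y _ _ ihx ihy => rw [map_mul, LinearEquiv.mul_apply, ihx, ihy]
  | inv x _ ih =>
    rw [← ih (geometricRep cs x⁻¹ v), ← LinearEquiv.mul_apply, ← map_mul, mul_inv_cancel, map_one,
      LinearEquiv.coe_one, id]

theorem simple_mem_standardSubgroup_iff (cs : CoxeterSystem M W) {J : Finset B} {i : B} :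
    cs.simple i ∈ standardSubgroup cs J ↔ i ∈ J := by
  refine ⟨fun h => ?_, fun h => Subgroup.subset_closure ⟨i, h, rfl⟩⟩
  by_contra hi
  have hfix := geometricRep_apply_of_notMem cs h hi (Finsupp.single i 1)
  rw [geometricRep_simple, simpleReflection_apply, corootForm_single_self] at hfix
  norm_num at hfix

theorem cos_pi_div_nonneg {n : ℕ} (hn : n ≠ 1) : 0 ≤ cos (π / n) := by
  obtain rfl | h : n = 0 ∨ 2 ≤ n := by lia
  · simp
  · have hle : π / n ≤ π / 2 := div_le_div_of_nonneg_left pi_pos.le two_pos (mod_cast h)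
    exact cos_nonneg_of_neg_pi_div_two_le_of_le
      (by linarith [pi_pos, show 0 ≤ π / n by positivity]) hle

theorem half_le_cos_pi_div {n : ℕ} (h1 : n ≠ 1) (h2 : n ≠ 2) : 1 / 2 ≤ cos (π / n) := by
  obtain rfl | h : n = 0 ∨ 3 ≤ n := by lia
  · norm_num
  · rw [← cos_pi_div_three]
    exact cos_le_cos_of_nonneg_of_le_pi (by positivity) (by linarith [pi_pos])
      (div_le_div_of_nonneg_left pi_pos.le three_pos (mod_cast h))

/-- The Coxeter graph, without its edge labels: two generators are joined when they are distinct
and do not commute. -/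
def coxeterGraph (M : CoxeterMatrix B) : SimpleGraph B where
  Adj i j := i ≠ j ∧ M i j ≠ 2
  symm := ⟨fun i j h => ⟨h.1.symm, M.symmetric j i ▸ h.2⟩⟩
  loopless := ⟨fun _ h => h.1 rfl⟩

theorem isAcyclic_coxeterGraph [Finite W] (cs : CoxeterSystem M W) :
    (coxeterGraph M).IsAcyclic := by
  obtain ⟨Q, hpos, hinv⟩ := exists_invariant_bilinForm_posDef (geometricRep cs)
  let α (i : B) : B →₀ ℝ := Finsupp.single i 1
  have hα (i : B) : 0 < Q (α i) (α i) := hpos _ (by simp [α])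
  have hinv' (i : B) (u v : B →₀ ℝ) :
      Q (simpleReflection M i u) (simpleReflection M i v) = Q u v := by
    simpa only [geometricRep_simple] using hinv (cs.simple i) u v
  have hgram (i j : B) : 2 * Q (α i) (α j) = -2 * cos (π / M i j) * Q (α i) (α i) := by
    rw [← corootForm_single]
    exact two_mul_apply_of_reflection_invariant Q _ (hinv' i) (α j)
  refine isAcyclic_of_posDef (v := α) hpos ?_ (fun i j hij => ?_) fun i j hij => ?_
  · exact Finsupp.linearIndependent_single_one ℝ B
  · nlinarith [hα i, hgram i j, cos_pi_div_nonneg (M.off_diagonal i j hij)]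
  · nlinarith [hα i, hgram i j, half_le_cos_pi_div (M.off_diagonal i j hij.1) hij.2]

theorem commute_simple_of_eq_two (cs : CoxeterSystem M W) {i j : B} (h : M i j = 2) :
    Commute (cs.simple i) (cs.simple j) := by
  have hpow := cs.simple_mul_simple_pow i j
  rwa [h, pow_two, mul_eq_one_iff_eq_inv, mul_inv_rev, cs.inv_simple, cs.inv_simple] at hpow

theorem exists_pairwise_commute_card_le_two_mul [Fintype B] [Finite W]
    (cs : CoxeterSystem M W) :
    ∃ I : Finset B, (I : Set B).Pairwise (fun i j => Commute (cs.simple i) (cs.simple j)) ∧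
      Fintype.card B ≤ 2 * I.card := by
  obtain ⟨I, hI, hcard⟩ := exists_isIndepSet_card_le_mul (isAcyclic_coxeterGraph cs).colorable_two
  refine ⟨I, fun i hi j hj hij => commute_simple_of_eq_two cs ?_, hcard⟩
  by_contra h2
  exact hI hi hj hij ⟨hij, h2⟩

end Geometric

section ExchangeCondition

open CoxeterSystem

variable {B W : Type*} [Group W] {M : CoxeterMatrix B} (cs : CoxeterSystem M W)

theorem prod_map_reverse_alternatingWord {G : Type*} [Monoid G] (f : B → G) (i j : B) (k : ℕ) :
    ((alternatingWord i j (2 * k)).reverse.map f).prod = (f j * f i) ^ k := by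
  induction k with
  | zero => simp [alternatingWord]
  | succ k ih =>
    rw [mul_add_one, alternatingWord_succ, alternatingWord_succ, pow_succ', ← ih]
    simp [mul_assoc]

theorem wordProd_alternatingWord_add_two_mul (i j : B) (k : ℕ) :
    cs.wordProd (alternatingWord i j (k + 2 * M i j)) = cs.wordProd (alternatingWord i j k) := by
  rw [prod_alternatingWord_eq_mul_pow, prod_alternatingWord_eq_mul_pow,
    Nat.add_mul_div_left _ _ two_pos, pow_add, cs.simple_mul_simple_pow, mul_one]
  simp [Nat.even_add]

theorem leftInvSeq_alternatingWord_two_mul_eq_append_self (i j : B) :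
    ∃ L, cs.leftInvSeq (alternatingWord i j (2 * M i j)) = L ++ L := by
  let L := (List.range (M i j)).map fun k => cs.wordProd (alternatingWord j i (2 * k + 1))
  refine ⟨L, List.ext_getElem (by simp [L, two_mul]) fun k hk _ => ?_⟩
  rw [cs.length_leftInvSeq, length_alternatingWord] at hk
  rw [cs.getElem_leftInvSeq_alternatingWord i j _ k hk, List.getElem_append]
  split_ifs with hlt
  · simp [L]
  · replace hlt : M i j ≤ k := by simpa [L] using hlt
    obtain ⟨l, rfl⟩ := Nat.exists_eq_add_of_le' hlt
    rw [show 2 * (l + M i j) + 1 = 2 * l + 1 + 2 * M j i by rw [M.symmetric j i]; ring,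
      wordProd_alternatingWord_add_two_mul]
    simp [L]

open scoped Classical in
/-- The involution `(t, ε) ↦ (sᵢ t sᵢ, ε + [t = sᵢ])` of `W × ZMod 2`. Composing these involutions
along a word records in the second coordinate how often, modulo two, `t` occurs in the inversion
sequence of the word. -/
noncomputable def reflectionPerm (i : B) : Equiv.Perm (W × ZMod 2) :=
  Function.Involutive.toPerm
    (fun p => (MulAut.conj (cs.simple i) p.1, p.2 + if p.1 = cs.simple i then 1 else 0)) <| by
    rintro ⟨t, ε⟩
    have hconj : MulAut.conj (cs.simple i) t = cs.simple i ↔ t = cs.simple i := by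
      rw [← (MulAut.conj (cs.simple i)).injective.eq_iff (a := t)]
      simp
    ext
    · simp [mul_assoc]
    · simp only [hconj, add_assoc, CharTwo.add_self_eq_zero, add_zero]

open scoped Classical in
theorem prod_map_reflectionPerm_apply (ω : List B) (t : W) (ε : ZMod 2) :
    (ω.map (reflectionPerm cs)).prod (t, ε) =
      (MulAut.conj (cs.wordProd ω) t, ε + (cs.rightInvSeq ω).count t) := by
  induction ω with
  | nil => simp
  | cons i ω ih =>
    have hconj : cs.wordProd ω * t * (cs.wordProd ω)⁻¹ = cs.simple i ↔
        (cs.wordProd ω)⁻¹ * cs.simple i * cs.wordProd ω = t := by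
      rw [← MulAut.conj_apply, ← MulAut.conj_symm_apply, MulEquiv.symm_apply_eq, eq_comm]
    rw [List.map_cons, List.prod_cons, Equiv.Perm.mul_apply, ih, cs.wordProd_cons, map_mul,
      rightInvSeq, List.count_cons]
    simp [reflectionPerm, hconj, add_assoc]

theorem isLiftable_reflectionPerm : M.IsLiftable (reflectionPerm cs) := by
  classical
  intro i j
  obtain ⟨L, hL⟩ := leftInvSeq_alternatingWord_two_mul_eq_append_self cs j i
  have hpow : cs.wordProd (alternatingWord j i (2 * M j i)).reverse = 1 :=
    (prod_map_reverse_alternatingWord cs.simple j i _).trans (cs.simple_mul_simple_pow' j i)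
  ext1 ⟨t, ε⟩
  rw [M.symmetric i j, ← prod_map_reverse_alternatingWord, prod_map_reflectionPerm_apply, hpow,
    cs.rightInvSeq_reverse, List.count_reverse, hL, List.count_append, Nat.cast_add,
    CharTwo.add_self_eq_zero]
  simp

/-- The action of the Coxeter group on `W × ZMod 2` extending `reflectionPerm`. Its existence shows
that the parity of the number of occurrences of `t` in the inversion sequence of a word depends
only on the element which the word represents. -/
noncomputable def reflectionAction : W →* Equiv.Perm (W × ZMod 2) :=
  cs.lift ⟨reflectionPerm cs, isLiftable_reflectionPerm cs⟩

open scoped Classical in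
theorem reflectionAction_wordProd_apply (ω : List B) (t : W) (ε : ZMod 2) :
    reflectionAction cs (cs.wordProd ω) (t, ε) =
      (MulAut.conj (cs.wordProd ω) t, ε + (cs.rightInvSeq ω).count t) := by
  rw [← prod_map_reflectionPerm_apply, wordProd, map_list_prod, List.map_map]
  congr! 3
  ext1 i
  exact cs.lift_apply_simple _ i

theorem simple_mem_rightInvSeq_of_isRightDescent {ω : List B} {i : B}
    (hi : cs.IsRightDescent (cs.wordProd ω) i) : cs.simple i ∈ cs.rightInvSeq ω := by
  classical
  by_contra hmem
  obtain ⟨η, hη, hωη⟩ := cs.exists_isReduced (cs.wordProd ω * cs.simple i)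
  have hprod : cs.wordProd (η.concat i) = cs.wordProd ω := by
    rw [cs.wordProd_concat, ← hωη, cs.simple_mul_simple_cancel_right]
  have hred : cs.IsReduced (η.concat i) := by
    rw [CoxeterSystem.IsReduced, hprod, List.length_concat, ← hη.eq, ← hωη]
    exact (cs.isRightDescent_iff.1 hi).symm
  have hcount : (cs.rightInvSeq (η.concat i)).count (cs.simple i) = 1 :=
    List.count_eq_one_of_mem hred.nodup_rightInvSeq (by rw [cs.rightInvSeq_concat]; simp)
  have hparity := reflectionAction_wordProd_apply cs (η.concat i) (cs.simple i) 0
  rw [hprod, reflectionAction_wordProd_apply, hcount, List.count_eq_zero_of_not_mem hmem] at hparity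
  simp at hparity

theorem exists_wordProd_eq_of_mem_standardSubgroup {J : Finset B} {w : W}
    (hw : w ∈ standardSubgroup cs J) : ∃ ω : List B, (∀ i ∈ ω, i ∈ J) ∧ cs.wordProd ω = w := by
  induction hw using Subgroup.closure_induction with
  | mem x hx =>
    obtain ⟨i, hi, rfl⟩ := hx
    exact ⟨[i], by simpa using hi, cs.wordProd_singleton i⟩
  | one => exact ⟨[], by simp, cs.wordProd_nil⟩
  | mul x y _ _ hx hy =>
    obtain ⟨⟨ω, hω, rfl⟩, η, hη, rfl⟩ := hx, hy
    exact ⟨ω ++ η, by simpa [or_imp, forall_and] using ⟨hω, hη⟩, cs.wordProd_append ω η⟩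
  | inv x _ hx =>
    obtain ⟨ω, hω, rfl⟩ := hx
    exact ⟨ω.reverse, by simpa using hω, cs.wordProd_reverse ω⟩

theorem wordProd_mem_standardSubgroup {J : Finset B} {ω : List B} (hω : ∀ i ∈ ω, i ∈ J) :
    cs.wordProd ω ∈ standardSubgroup cs J :=
  list_prod_mem <| List.forall_mem_map.2 fun i hi => Subgroup.subset_closure ⟨i, hω i hi, rfl⟩

theorem mem_standardSubgroup_of_mem_rightInvSeq {J : Finset B} {ω : List B}
    (hω : ∀ i ∈ ω, i ∈ J) {t : W} (ht : t ∈ cs.rightInvSeq ω) : t ∈ standardSubgroup cs J := by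
  induction ω with
  | nil => simp at ht
  | cons i ω ih =>
    rw [List.forall_mem_cons] at hω
    obtain rfl | ht := List.mem_cons.1 ht
    · have hmem := wordProd_mem_standardSubgroup cs hω.2
      exact mul_mem (mul_mem (inv_mem hmem) (Subgroup.subset_closure ⟨i, hω.1, rfl⟩)) hmem
    · exact ih hω.2 ht

theorem mem_of_isRightDescent_of_mem_standardSubgroup {J : Finset B} {w : W}
    (hw : w ∈ standardSubgroup cs J) {i : B} (hi : cs.IsRightDescent w i) : i ∈ J := by
  obtain ⟨ω, hω, rfl⟩ := exists_wordProd_eq_of_mem_standardSubgroup cs hw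
  rw [← simple_mem_standardSubgroup_iff cs]
  exact mem_standardSubgroup_of_mem_rightInvSeq cs hω
    (simple_mem_rightInvSeq_of_isRightDescent cs hi)

theorem standardSubgroup_inter [DecidableEq B] (J K : Finset B) :
    standardSubgroup cs (J ∩ K) = standardSubgroup cs J ⊓ standardSubgroup cs K := by
  refine le_antisymm (le_inf ?_ ?_) fun w hw => ?_
  · exact Subgroup.closure_mono (Set.image_mono (mod_cast Finset.inter_subset_left))
  · exact Subgroup.closure_mono (Set.image_mono (mod_cast Finset.inter_subset_right))
  induction hn : cs.length w using Nat.strong_induction_on generalizing w with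
  | _ n ih =>
    obtain rfl | hne := eq_or_ne w 1
    · exact one_mem _
    obtain ⟨i, hi⟩ := cs.exists_rightDescent_of_ne_one hne
    have hiJ := mem_of_isRightDescent_of_mem_standardSubgroup cs hw.1 hi
    have hiK := mem_of_isRightDescent_of_mem_standardSubgroup cs hw.2 hi
    have hsimple {L : Finset B} (hL : i ∈ L) : cs.simple i ∈ standardSubgroup cs L :=
      (simple_mem_standardSubgroup_iff cs).2 hL
    rw [← cs.simple_mul_simple_cancel_right (w := w) i]
    exact mul_mem (ih _ (hn ▸ hi) _ ⟨mul_mem hw.1 (hsimple hiJ), mul_mem hw.2 (hsimple hiK)⟩ rfl)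
      (hsimple (Finset.mem_inter.2 ⟨hiJ, hiK⟩))

theorem standardSubgroup_empty : standardSubgroup cs ∅ = ⊥ := by
  simp [standardSubgroup]

end ExchangeCondition

section CosetSums

open Function

variable {G ι R : Type*} [Group G] [AddCommMonoid R] {H : Finset ι → Subgroup G}
  {T : Finset ι} {k : ℕ} {f : G → R}

/-- The condition dual to membership in a Coxeter code: `f` sums to zero over every left coset of
every subgroup `H K` with `K ⊆ T` of size `k`. -/
def CosetSumsVanish (H : Finset ι → Subgroup G) (T : Finset ι) (k : ℕ) (f : G → R) : Prop :=
  ∀ K ⊆ T, K.card = k → ∀ w : G, ∑ᶠ x ∈ w • (H K : Set G), f x = 0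

theorem mem_smul_iff_of_mem_smul {J K : Subgroup G} (hJK : J ≤ K) {a w x : G}
    (hx : x ∈ w • (J : Set G)) : x ∈ a • (K : Set G) ↔ w ∈ a • (K : Set G) := by
  rw [mem_leftCoset_iff, SetLike.mem_coe] at hx
  rw [mem_leftCoset_iff, mem_leftCoset_iff, SetLike.mem_coe, SetLike.mem_coe,
    ← K.mul_mem_cancel_right (y := a⁻¹ * w) (hJK hx)]
  simp [mul_assoc]

namespace CosetSumsVanish

theorem eq_zero (hbot : H ∅ = ⊥) (hf : CosetSumsVanish H T 0 f) : f = 0 := by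
  funext w
  simpa [hbot] using hf ∅ (Finset.empty_subset T) rfl w

theorem indicator (hmono : Monotone H) (hf : CosetSumsVanish H T k f) {T' : Finset ι}
    (hT' : T' ⊆ T) (a : G) : CosetSumsVanish H T' k ((a • (H T' : Set G)).indicator f) := by
  intro K hK hcard w
  have hmem {x : G} (hx : x ∈ w • (H K : Set G)) :
      x ∈ a • (H T' : Set G) ↔ w ∈ a • (H T' : Set G) :=
    mem_smul_iff_of_mem_smul (hmono hK) hx
  by_cases hw : w ∈ a • (H T' : Set G)
  · rw [← hf K (hK.trans hT') hcard w]
    exact finsum_mem_congr rfl fun x hx => Set.indicator_of_mem ((hmem hx).2 hw) f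
  · exact finsum_mem_eq_zero_of_forall_eq_zero fun x hx =>
      Set.indicator_of_notMem (fun h => hw ((hmem hx).1 h)) f

variable [DecidableEq ι]

theorem of_support_subset_leftCoset (hinf : ∀ J K, H (J ∩ K) = H J ⊓ H K) {s : ι} (hs : s ∉ T)
    {a : G} (ha : support f ⊆ a • (H T : Set G))
    (hf : CosetSumsVanish H (insert s T) (k + 1) f) : CosetSumsVanish H T k f := by
  intro K hK hcard w
  have hinter : insert s K ∩ T = K := by
    rw [Finset.insert_inter_of_notMem hs, Finset.inter_eq_left.2 hK]
  have hHK : H K = H (insert s K) ⊓ H T := by rw [← hinf, hinter]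
  by_cases hw : w ∈ a • (H T : Set G)
  · rw [← hf (insert s K) (Finset.insert_subset_insert s hK)
      (by rw [Finset.card_insert_of_notMem fun h => hs (hK h), hcard]) w]
    refine finsum_mem_inter_support_eq' _ _ _ fun x hx => ?_
    have hx' : w⁻¹ * x ∈ H T := by
      rw [mem_leftCoset_iff] at hw
      simpa [mul_assoc] using mul_mem (inv_mem hw) ((mem_leftCoset_iff a).1 (ha hx))
    rw [mem_leftCoset_iff, mem_leftCoset_iff, hHK]
    exact ⟨And.left, fun h => ⟨h, hx'⟩⟩
  · refine finsum_mem_eq_zero_of_forall_eq_zero fun x hx => by_contra fun hfx => hw ?_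
    exact (mem_smul_iff_of_mem_smul (hHK ▸ inf_le_right) hx).1 (ha hfx)

/- Remove an element `s` of `T`. If the support lies in one coset of `H (T \ {s})`, then the sums
over cosets of `H (K ∪ {s})` are sums over cosets of `H K`, so `k` drops by one as well. Otherwise
`f` restricts to nonzero functions on two such cosets. -/
theorem two_pow_le_encard_support (hbot : H ∅ = ⊥) (hinf : ∀ J K, H (J ∩ K) = H J ⊓ H K)
    (hf : CosetSumsVanish H T k f) (hne : f ≠ 0) : 2 ^ (T.card + 1 - k) ≤ (support f).encard := by
  have hmono : Monotone H := fun J K hJK => by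
    rw [← inf_eq_left, ← hinf, Finset.inter_eq_left.2 hJK]
  induction T using Finset.induction_on generalizing k f with
  | empty =>
    obtain _ | k := k
    · exact absurd (hf.eq_zero hbot) hne
    · simpa using hne
  | insert s T hs ih =>
    rw [Finset.card_insert_of_notMem hs]
    obtain _ | k := k
    · exact absurd (hf.eq_zero hbot) hne
    obtain ⟨a, ha⟩ := support_nonempty_iff.2 hne
    by_cases hsub : support f ⊆ a • (H T : Set G)
    · simpa using ih (hf.of_support_subset_leftCoset hinf hs hsub) hne
    obtain ⟨b, hb, hab⟩ := Set.not_subset.1 hsub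
    have hcoset {c : G} (hc : f c ≠ 0) : 2 ^ (T.card - k) ≤
        (c • (H T : Set G) ∩ support f).encard := by
      rw [← Set.support_indicator]
      have hne : (c • (H T : Set G)).indicator f ≠ 0 := fun h => hc <| by
        simpa [mem_leftCoset_iff, one_mem] using congrFun h c
      simpa using ih (hf.indicator hmono (Finset.subset_insert s T) c) hne
    have hdisj : Disjoint (a • (H T : Set G) ∩ support f) (b • (H T : Set G) ∩ support f) :=
      Set.disjoint_left.2 fun x hxa hxb =>
        hab ((mem_smul_iff_of_mem_smul le_rfl hxb.1).1 hxa.1)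
    calc (2 : ℕ∞) ^ (T.card + 1 + 1 - (k + 1)) ≤ 2 ^ (T.card - k) + 2 ^ (T.card - k) := by
          rw [← two_mul, ← pow_succ']
          exact pow_le_pow_right₀ one_le_two (by lia)
      _ ≤ (a • (H T : Set G) ∩ support f).encard + (b • (H T : Set G) ∩ support f).encard :=
          add_le_add (hcoset ha) (hcoset hb)
      _ ≤ (support f).encard := by
          rw [← Set.encard_union_eq hdisj]
          exact Set.encard_le_encard
            (Set.union_subset Set.inter_subset_right Set.inter_subset_right)

end CosetSumsVanish

end CosetSums

section Weight

open Function

theorem card_closure_range_dvd_prod_orderOf {G ι : Type*} [Group G] [Fintype ι] {s : ι → G}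
    (hs : Pairwise fun i j => Commute (s i) (s j)) :
    Nat.card (Subgroup.closure (Set.range s)) ∣ ∏ i, orderOf (s i) := by
  have hcomm : Pairwise fun i j => ∀ x y, x ∈ Subgroup.zpowers (s i) →
      y ∈ Subgroup.zpowers (s j) → Commute x y := by
    rintro i j hij _ _ ⟨k, rfl⟩ ⟨l, rfl⟩
    exact (hs hij).zpow_zpow k l
  have hrange : (Subgroup.noncommPiCoprod hcomm).range = Subgroup.closure (Set.range s) := by
    rw [Subgroup.noncommPiCoprod_range, ← Set.iUnion_singleton_eq_range, Subgroup.closure_iUnion]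
    simp only [Subgroup.zpowers_eq_closure]
  rw [← hrange]
  simpa [Nat.card_pi] using Subgroup.card_range_dvd (Subgroup.noncommPiCoprod hcomm)

theorem encard_support_eq_hammingNorm {ι R : Type*} [Fintype ι] [Zero R] [DecidableEq R]
    (f : ι → R) : (support f).encard = hammingNorm f := by
  rw [hammingNorm, ← Set.encard_coe_eq_coe_finsetCard]
  simp [support]

theorem indicator_coe_subgroup_ne_zero {G : Type*} [Group G] (H : Subgroup G) :
    indicator (H : Set G) ≠ 0 := fun h => by
  simpa [indicator, one_mem] using congrFun h 1

theorem hammingNorm_indicator {W : Type*} [Fintype W] (U : Set W) :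
    hammingNorm (indicator U) = Nat.card U := by
  rw [← ENat.natCast_inj, ← encard_support_eq_hammingNorm, indicator, Set.support_indicator]
  simp [Nat.card_coe_set_eq, Set.Finite.cast_ncard_eq U.toFinite]

theorem minDist_eq_hammingNorm {W : Type*} [Fintype W] {C : Submodule (ZMod 2) (W → ZMod 2)}
    {f : W → ZMod 2} (hf : f ∈ C) (hne : f ≠ 0)
    (hmin : ∀ g ∈ C, g ≠ 0 → hammingNorm f ≤ hammingNorm g) : minDist C = hammingNorm f := by
  refine IsLeast.csInf_eq ⟨⟨f, hf, 0, zero_mem C, hne, hammingDist_zero_right f⟩, ?_⟩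
  rintro d ⟨x, hx, y, hy, hxy, rfl⟩
  rw [hammingDist_eq_hammingNorm]
  exact hmin _ (add_mem (neg_mem hx) hy) fun h => hxy (neg_add_eq_zero.1 h)

theorem finsum_mem_smul_eq_zero {G R : Type*} [Group G] [AddCommMonoid R] {H : Subgroup G}
    [Finite H] {s : G} (hs : s ∈ H) (hne : s ≠ 1) (hss : s * s = 1) {f : G → R}
    (hf : ∀ x, f x + f (x * s) = 0) (w : G) : ∑ᶠ x ∈ w • (H : Set G), f x = 0 := by
  have hfin : (w • (H : Set G)).Finite := (H : Set G).toFinite.smul_set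
  rw [finsum_mem_eq_finite_toFinset_sum f hfin]
  refine Finset.sum_involution (fun x _ => x * s) (fun x _ => hf x) (fun x _ _ h => hne ?_)
    (fun x hx => ?_) fun x _ => by rw [mul_assoc, hss, mul_one]
  · exact mul_eq_left.1 h
  · rw [Set.Finite.mem_toFinset, mem_leftCoset_iff, SetLike.mem_coe] at hx ⊢
    rw [← mul_assoc]
    exact mul_mem hx hs

variable {B W : Type*} [Group W] {M : CoxeterMatrix B} (cs : CoxeterSystem M W)

theorem simple_ne_one (i : B) : cs.simple i ≠ 1 := fun h => by
  simpa [h] using cs.length_simple i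

/- Right multiplication by `sᵢ` preserves the cosets of both subgroups, so it splits their
intersection into pairs. -/
theorem finsum_mem_indicator_smul_standardSubgroup [Finite W] {J K : Finset B} {i : B}
    (hiJ : i ∈ J) (hiK : i ∈ K) (σ w : W) :
    ∑ᶠ x ∈ w • (standardSubgroup cs K : Set W),
      indicator (σ • (standardSubgroup cs J : Set W)) x = 0 := by
  classical
  refine finsum_mem_smul_eq_zero ((simple_mem_standardSubgroup_iff cs).2 hiK)
    (simple_ne_one cs i) (cs.simple_mul_simple_self i) (fun x => ?_) w
  have hmem : x * cs.simple i ∈ σ • (standardSubgroup cs J : Set W) ↔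
      x ∈ σ • (standardSubgroup cs J : Set W) :=
    mem_smul_iff_of_mem_smul le_rfl
      ((mem_leftCoset_iff x).2 (by simpa using (simple_mem_standardSubgroup_iff cs).2 hiJ))
  simp only [indicator, Set.indicator_apply, hmem, Pi.one_apply, CharTwo.add_self_eq_zero]

theorem two_pow_le_hammingNorm_indicator_standardSubgroup [Fintype W] (J : Finset B) :
    2 ^ J.card ≤ hammingNorm (indicator (standardSubgroup cs J : Set W)) := by
  classical
  have hvanish : CosetSumsVanish (standardSubgroup cs) J 1
      (indicator (standardSubgroup cs J : Set W)) := by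
    intro K hKJ hK w
    obtain ⟨i, rfl⟩ := Finset.card_eq_one.1 hK
    simpa using finsum_mem_indicator_smul_standardSubgroup cs
      (hKJ (Finset.mem_singleton_self i)) (Finset.mem_singleton_self i) 1 w
  have h := hvanish.two_pow_le_encard_support (standardSubgroup_empty cs)
    (standardSubgroup_inter cs) (indicator_coe_subgroup_ne_zero _)
  rw [encard_support_eq_hammingNorm, Nat.add_sub_cancel] at h
  exact_mod_cast h

theorem hammingNorm_indicator_standardSubgroup [Fintype W] {J : Finset B}
    (hJ : (J : Set B).Pairwise fun i j => Commute (cs.simple i) (cs.simple j)) :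
    hammingNorm (indicator (standardSubgroup cs J : Set W)) = 2 ^ J.card := by
  apply le_antisymm
  · have hdvd : Nat.card (standardSubgroup cs J) ∣ ∏ i : J, orderOf (cs.simple i) := by
      rw [standardSubgroup, Set.image_eq_range]
      exact card_closure_range_dvd_prod_orderOf fun i j hij =>
        hJ i.2 j.2 (Subtype.coe_ne_coe.2 hij)
    have horder (i : B) : orderOf (cs.simple i) ∣ 2 :=
      orderOf_dvd_of_pow_eq_one (cs.simple_sq i)
    rw [hammingNorm_indicator]
    refine Nat.le_of_dvd (by positivity) (hdvd.trans ?_)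
    simpa using Finset.prod_dvd_prod_of_dvd (s := Finset.univ) _ (fun _ : J => 2)
      fun i _ => horder i
  · exact two_pow_le_hammingNorm_indicator_standardSubgroup cs J

variable [Fintype B]

theorem indicator_standardSubgroup_mem_code {r : ℤ} {J : Finset B}
    (hJ : (J.card : ℤ) = Fintype.card B - r) :
    indicator (standardSubgroup cs J : Set W) ∈ code cs r :=
  Submodule.subset_span ⟨1, J, hJ, by rw [one_smul]⟩

theorem cosetSumsVanish_of_mem_code [Finite W] {r : ℕ} {f : W → ZMod 2} (hf : f ∈ code cs r) :
    CosetSumsVanish (standardSubgroup cs) Finset.univ (r + 1) f := by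
  classical
  intro K _ hK w
  have hfin := (w • (standardSubgroup cs K : Set W)).toFinite
  induction hf using Submodule.span_induction with
  | mem f hf =>
    obtain ⟨σ, J, hJ, rfl⟩ := hf
    obtain ⟨i, hi⟩ : (J ∩ K).Nonempty := by
      rw [← Finset.card_pos]
      have := Finset.card_union_add_card_inter J K
      have := Finset.card_le_univ (J ∪ K)
      lia
    exact finsum_mem_indicator_smul_standardSubgroup cs (Finset.mem_inter.1 hi).1
      (Finset.mem_inter.1 hi).2 σ w
  | zero => simp
  | add f g _ _ hf hg => simp [finsum_mem_add_distrib hfin, hf, hg]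
  | smul c f _ hf => rw [← smul_zero c, ← hf, smul_finsum_mem hfin]; rfl

theorem two_pow_le_hammingNorm_of_mem_code [Fintype W] {r : ℕ} {f : W → ZMod 2}
    (hf : f ∈ code cs r) (hne : f ≠ 0) : 2 ^ (Fintype.card B - r) ≤ hammingNorm f := by
  classical
  have h := (cosetSumsVanish_of_mem_code cs hf).two_pow_le_encard_support
    (standardSubgroup_empty cs) (standardSubgroup_inter cs) hne
  rw [encard_support_eq_hammingNorm, Nat.add_sub_add_right, Finset.card_univ] at h
  exact_mod_cast h

end Weight

end CoxeterCode

theorem mainTheorem7 {B W : Type*} [Fintype B] [Group W] [Fintype W]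
    {M : CoxeterMatrix B} (cs : CoxeterSystem M W)
    (m r : ℕ) (hm : Fintype.card B = m) (hr : m / 2 ≤ r) (hrm : r ≤ m) :
    CoxeterCode.minDist (CoxeterCode.code cs r) = 2 ^ (m - r) ∧
      ∃ J : Finset B, J.card = m - r ∧
        (J : Set B).Pairwise (fun i j => Commute (cs.simple i) (cs.simple j)) ∧
        CoxeterCode.indicator (CoxeterCode.standardSubgroup cs J : Set W) ∈
          CoxeterCode.code cs r ∧
        hammingNorm (CoxeterCode.indicator (CoxeterCode.standardSubgroup cs J : Set W)) =
          2 ^ (m - r) := by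
  obtain ⟨I, hI, hIcard⟩ := CoxeterCode.exists_pairwise_commute_card_le_two_mul cs
  obtain ⟨J, hJI, hJcard⟩ := Finset.exists_subset_card_eq (show m - r ≤ I.card by lia)
  have hJ := hI.mono (Finset.coe_subset.2 hJI)
  have hmem := CoxeterCode.indicator_standardSubgroup_mem_code cs (r := r) (J := J) (by lia)
  have hweight := CoxeterCode.hammingNorm_indicator_standardSubgroup cs hJ
  rw [hJcard] at hweight
  refine ⟨?_, J, hJcard, hJ, hmem, hweight⟩
  rw [← hweight]
  refine CoxeterCode.minDist_eq_hammingNorm hmem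
    (CoxeterCode.indicator_coe_subgroup_ne_zero _) fun g hg hne => ?_
  rw [hweight, ← hm]
  exact CoxeterCode.two_pow_le_hammingNorm_of_mem_code cs hg hne
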